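/- Let $R_1, R_2$ be discrete valuation domains with maximal ideals $P_1, P_2$, let $\overline{R}$ be a field, let $v_i : R_i \to \overline{R}$ ($i=1,2$) be surjective ring homomorphisms, and let $R = \{(r,s)\in R_1\times R_2 : v_1(r)=v_2(s)\}$ be the pullback ring, with maximal ideal $P=P_1\oplus P_2$ (so $R/P\cong\overline{R}$). Terminology. A proper ideal $I$ of $R$ is *2-absorbing primary* if $abc\in I$ implies $ab\in I$ or $ac\in\sqrt I$ or $bc\in\sqrt I$. An $R$-module $M$ is a *pseudo-absorbing primary multiplication module* if every proper submodule $N$ of $M$ for which $(N:_R M)$ is a 2-absorbing primary ideal has the form $N=IM$ for some ideal $I$ of $R$. A module is *indecomposable* if it is nonzero and is not a direct sum of two nonzero submodules. An $R$-module is *separated* if it is isomorphic to an $R$-submodule of $S_1\oplus S_2$ for some $R_i$-modules $S_i$ ($i=1,2$), where $(r,s)\in R$ acts by $r$ on $S_1$ and by $s$ on $S_2$. A *separated representation* of $M$ is an epimorphism of $R$-modules $\varphi:S\to M$ with $S$ separated such that whenever $\varphi = (S\xrightarrow{f}S'\to M)$ with $S'$ separated, $f$ is one-to-one. The *top* of $M$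 is the $R/P$-vector space $M/PM$. A submodule $N$ of a module $B$ is *pure* if every finite system of linear equations with constants in $N$ that is solvable in $B$ is solvable in $N$. A module $S$ is *pure-injective* if every homomorphism $N\to S$ from a pure submodule $N$ of an $R$-module $B$ extends to a homomorphism $B\to S$. **Corollary.** Let $M$ be an indecomposable non-separated pseudo-absorbing primary multiplication $R$-module such that $M/PM$ is finite-dimensional over $R/P$, and let $0\to K\to S\xrightarrow{\varphi} M\to 0$ be a separated representation of $M$. Then $S$ is a pure-injective $R$-module, its top $S/PS$ is finite-dimensional over $R/P$, and $S/PS\cong M/PM$ as vector spaces over $R/P$. -/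

import Mathlib

universe w

namespace PullbackModules

section General

variable {R : Type*} [CommRing R]

/-- A proper ideal `I` is 2-absorbing primary if `a b c ∈ I` implies `a b ∈ I`, or `a c ∈ √I`,
or `b c ∈ √I`. -/
def IsTwoAbsorbingPrimary (I : Ideal R) : Prop :=
  I ≠ ⊤ ∧ ∀ a b c : R, a * b * c ∈ I → a * b ∈ I ∨ a * c ∈ I.radical ∨ b * c ∈ I.radical

variable {M : Type*} [AddCommGroup M] [Module R M]

/-- A proper submodule `N` of `M` is pseudo-absorbing primary if `(N :_R M)` is a 2-absorbing
primary ideal of `R`. -/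
def IsPseudoAbsorbingPrimary (N : Submodule R M) : Prop :=
  N ≠ ⊤ ∧ IsTwoAbsorbingPrimary (N.colon (Set.univ : Set M))

/-- A submodule `N` of `M` is pure if every finite system of `R`-linear equations with constants
in `N` that is solvable in `M` is solvable in `N`. -/
def IsPure (N : Submodule R M) : Prop :=
  ∀ (m n : ℕ) (A : Matrix (Fin m) (Fin n) R) (b : Fin m → N),
    (∃ x : Fin n → M, ∀ i, ∑ j, A i j • x j = (b i : M)) →
    ∃ y : Fin n → N, ∀ i, ∑ j, A i j • y j = b i

variable (R M)

/-- `M` is a pseudo-absorbing primary multiplication module if every pseudo-absorbing primary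
submodule of `M` has the form `I M` for an ideal `I` of `R`. -/
def IsPseudoAbsorbingPrimaryMultiplication : Prop :=
  ∀ N : Submodule R M, IsPseudoAbsorbingPrimary N → ∃ I : Ideal R, N = I • (⊤ : Submodule R M)

/-- `M` is indecomposable: nonzero, and not the direct sum of two nonzero submodules. -/
def IsIndecomposable : Prop :=
  Nontrivial M ∧ ∀ A B : Submodule R M, IsCompl A B → A = ⊥ ∨ B = ⊥

/-- `M` is pure-injective: every homomorphism to `M` from a pure submodule `N` of a module `B`
extends to `B`. The modules `B` range over the (arbitrary) universe `w`. -/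
def IsPureInjective : Prop :=
  ∀ (B : Type w) [AddCommGroup B] [Module R B] (N : Submodule R B), IsPure N →
    ∀ f : N →ₗ[R] M, ∃ g : B →ₗ[R] M, ∀ x : N, g x = f x

end General

section Pullback

variable {R₁ R₂ k : Type*} [CommRing R₁] [CommRing R₂] [Field k]

/-- The pullback ring `(R₁ → k ← R₂)`: all pairs `(r, s)` with `v₁ r = v₂ s`. -/
abbrev pullbackRing (v₁ : R₁ →+* k) (v₂ : R₂ →+* k) : Subring (R₁ × R₂) :=
  (v₁.comp (RingHom.fst R₁ R₂)).eqLocus (v₂.comp (RingHom.snd R₁ R₂))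

/-- The ideal `P = P₁ ⊕ P₂` of the pullback ring of two local rings `R₁`, `R₂` with maximal
ideals `P₁`, `P₂`. -/
def idealP [IsLocalRing R₁] [IsLocalRing R₂] (v₁ : R₁ →+* k) (v₂ : R₂ →+* k) :
    Ideal (pullbackRing v₁ v₂) :=
  (Ideal.prod (IsLocalRing.maximalIdeal R₁) (IsLocalRing.maximalIdeal R₂)).comap
    (pullbackRing v₁ v₂).subtype

/-- A module `S` over the pullback ring is separated if it embeds into a direct sum `S₁ ⊕ S₂` of
an `R₁`-module and an `R₂`-module, on which `(r, s)` acts as `r` on `S₁` and as `s` on `S₂`. -/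
def IsSeparated (v₁ : R₁ →+* k) (v₂ : R₂ →+* k)
    (S : Type w) [AddCommGroup S] [Module (pullbackRing v₁ v₂) S] : Prop :=
  ∃ (S₁ S₂ : Type w) (_ : AddCommGroup S₁) (_ : AddCommGroup S₂)
    (_ : Module R₁ S₁) (_ : Module R₂ S₂) (f : S →+ S₁ × S₂),
    Function.Injective f ∧
      ∀ (r : pullbackRing v₁ v₂) (x : S), f (r • x) = (r.1.1 • (f x).1, r.1.2 • (f x).2)

/-- A separated representation of `M`: an epimorphism `φ : S → M` with `S` separated such that, in
every factorization `φ = (S → S' → M)` with `S'` separated, the map `S → S'` is one-to-one. -/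
structure IsSeparatedRepresentation {v₁ : R₁ →+* k} {v₂ : R₂ →+* k}
    {S : Type w} [AddCommGroup S] [Module (pullbackRing v₁ v₂) S]
    {M : Type*} [AddCommGroup M] [Module (pullbackRing v₁ v₂) M]
    (φ : S →ₗ[pullbackRing v₁ v₂] M) : Prop where
  separated : IsSeparated v₁ v₂ S
  surjective : Function.Surjective φ
  injective_of_factorization : ∀ (S' : Type w) [AddCommGroup S'] [Module (pullbackRing v₁ v₂) S']
    (f : S →ₗ[pullbackRing v₁ v₂] S') (g : S' →ₗ[pullbackRing v₁ v₂] M),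
    IsSeparated v₁ v₂ S' → φ = g ∘ₗ f → Function.Injective f

/-- The top `M / PM` of a module `M` over the pullback ring; it is a vector space over the residue
field `R / P`. -/
abbrev ModuleTop [IsLocalRing R₁] [IsLocalRing R₂] (v₁ : R₁ →+* k) (v₂ : R₂ →+* k)
    (M : Type*) [AddCommGroup M] [Module (pullbackRing v₁ v₂) M] : Type _ :=
  M ⧸ (idealP v₁ v₂ • (⊤ : Submodule (pullbackRing v₁ v₂) M))

end Pullback

end PullbackModules

/-!
Write `R` for the pullback ring and `P₁ = P ∩ (R₁ ⊕ 0)`, `P₂ = P ∩ (0 ⊕ R₂)`, so that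
`P = P₁ ⊕ P₂`.

Every proper ideal of `R` is 2-absorbing primary (`isTwoAbsorbingPrimary_of_ne_top`), so `M` is a
multiplication module in the usual sense, and a multiplication module over a local ring is cyclic
(`exists_span_singleton_eq_top_of_isLocalRing`).

A module `S` is separated if and only if `P₁ S ∩ P₂ S = 0`. In terms of this criterion, minimality
of a separated representation `φ : S → M` with kernel `K` gives `P K = 0`
(`IsSeparatedRepresentation.smul_eq_zero`) and `K ⊆ P S`
(`IsSeparatedRepresentation.ker_le_idealP_smul`). The second inclusion yields `S / P S ≅ M / P M`;
together they show that `S` is cyclic, generated by any lift `s` of a generator of `M`. As `M` is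
not separated, some element `d` of `P` with two nonzero components satisfies `d s ∈ K`, hence
`P d s = 0` (`IsSeparatedRepresentation.exists_smul_eq_zero`). So `S` is a quotient of a submodule
of `R₁ / (d₁ ^ 2) ⊕ R₂ / (d₂ ^ 2)`, and is Artinian.

Finally, an Artinian module `S` over any commutative ring is pure-injective
(`isPureInjective_of_isArtinian`). A homomorphism from a pure submodule of `B` sends finite systems
solvable in `B` to systems solvable in `S`, and this property can be kept while extending the
homomorphism to one more element `b`: the admissible values at `b` form a family of cosets of
submodules of `S`, closed under finite intersections and without empty member, which has a common
point because `S` is Artinian. No completeness of `R₁` and `R₂` is needed.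
-/

namespace PullbackModules

/-! ### Artinian modules over commutative rings are pure-injective -/

section PureInjective

variable {R : Type*} [CommRing R]

/-- Artinian modules are linearly compact: a nonempty family of cosets which is closed under
binary intersections and does not contain the empty set has a common point, because a member
with minimal direction lies in every other member. -/
theorem exists_mem_of_directed_affineSubspaces {S : Type*} [AddCommGroup S] [Module R S]
    [IsArtinian R S] (C : Set (AffineSubspace R S)) (hne : C.Nonempty)
    (hmem : ∀ T ∈ C, (T : Set S).Nonempty) (hinf : ∀ T ∈ C, ∀ U ∈ C, T ⊓ U ∈ C) :
    ∃ s : S, ∀ T ∈ C, s ∈ T := by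
  obtain ⟨_, ⟨T, hT, rfl⟩, hmin⟩ := IsArtinian.set_has_minimal
    (AffineSubspace.direction '' C) (hne.image _)
  obtain ⟨s, hs⟩ := hmem T hT
  refine ⟨s, fun U hU => ?_⟩
  have hTU := hinf T hT U hU
  have hdir : (T ⊓ U).direction = T.direction :=
    (AffineSubspace.direction_le inf_le_left).eq_of_not_lt (hmin _ ⟨_, hTU, rfl⟩)
  have heq : T ⊓ U = T :=
    AffineSubspace.eq_of_direction_eq_of_nonempty_of_le hdir (hmem _ hTU) inf_le_left
  have hs' : s ∈ T ⊓ U := heq.symm ▸ hs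
  exact (AffineSubspace.mem_inf_iff _ _ _).1 hs' |>.2

variable {B S : Type*} [AddCommGroup B] [Module R B] [AddCommGroup S] [Module R S]

/-- A partial homomorphism `f` from `B` to `S` preserves solvability if every finite linear system
with constants in its domain that is solvable in `B` has an image under `f` that is solvable
in `S`. -/
def PreservesSolvability (f : B →ₗ.[R] S) : Prop :=
  ∀ (ι κ : Type) [Fintype ι] [Fintype κ] (A : ι → κ → R) (c : ι → f.domain),
    (∃ x : κ → B, ∀ i, ∑ j, A i j • x j = (c i : B)) →
    ∃ y : κ → S, ∀ i, ∑ j, A i j • y j = f (c i)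

/-- The values that a further unknown with coefficients `d` may take in `S` if the system with
coefficients `A` is to have right-hand side `c`. As `R` is commutative, this is a coset of a
submodule of `S`. -/
def solutionCoset {ι κ : Type} [Fintype κ] (A : ι → κ → R) (d : ι → R) (c : ι → S) :
    AffineSubspace R S where
  carrier := {s | ∃ y : κ → S, ∀ i, ∑ j, A i j • y j + d i • s = c i}
  smul_vsub_vadd_mem' := by
    rintro r s₁ s₂ s₃ ⟨y₁, h₁⟩ ⟨y₂, h₂⟩ ⟨y₃, h₃⟩
    refine ⟨r • (y₁ - y₂) + y₃, fun i => ?_⟩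
    have : ∑ j, A i j • (r • (y₁ - y₂) + y₃) j + d i • (r • (s₁ - s₂) + s₃) =
        r • ((∑ j, A i j • y₁ j + d i • s₁) - (∑ j, A i j • y₂ j + d i • s₂)) +
          (∑ j, A i j • y₃ j + d i • s₃) := by
      simp only [Pi.add_apply, Pi.smul_apply, Pi.sub_apply, smul_add, smul_sub,
        Finset.sum_add_distrib, Finset.sum_sub_distrib, Finset.smul_sum, smul_comm r]
      abel
    simpa [h₁, h₂, h₃] using this

theorem mem_solutionCoset {ι κ : Type} [Fintype κ] {A : ι → κ → R} {d : ι → R} {c : ι → S}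
    {s : S} : s ∈ solutionCoset A d c ↔ ∃ y : κ → S, ∀ i, ∑ j, A i j • y j + d i • s = c i :=
  Iff.rfl

/-- In an Artinian module `S`, the conditions which the finite systems satisfied by `b` impose on a
prospective image of `b` can be met simultaneously. -/
theorem PreservesSolvability.exists_image [IsArtinian R S] {f : B →ₗ.[R] S}
    (hf : PreservesSolvability f) (b : B) :
    ∃ s : S, ∀ (ι κ : Type) [Fintype ι] [Fintype κ] (A : ι → κ → R) (d : ι → R)
      (c : ι → f.domain), (∃ x : κ → B, ∀ i, ∑ j, A i j • x j + d i • b = (c i : B)) →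
      ∃ y : κ → S, ∀ i, ∑ j, A i j • y j + d i • s = f (c i) := by
  let C : Set (AffineSubspace R S) := {T | ∃ (ι κ : Type) (_ : Fintype ι) (_ : Fintype κ)
    (A : ι → κ → R) (d : ι → R) (c : ι → f.domain),
    (∃ x : κ → B, ∀ i, ∑ j, A i j • x j + d i • b = (c i : B)) ∧
    T = solutionCoset A d fun i => f (c i)}
  obtain ⟨s, hs⟩ : ∃ s : S, ∀ T ∈ C, s ∈ T := by
    apply exists_mem_of_directed_affineSubspaces
    · exact ⟨_, Empty, Empty, inferInstance, inferInstance, Empty.elim, Empty.elim, Empty.elim,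
        ⟨Empty.elim, fun i => i.elim⟩, rfl⟩
    · rintro _ ⟨ι, κ, _, _, A, d, c, ⟨x, hx⟩, rfl⟩
      obtain ⟨y, hy⟩ := hf ι (Option κ) (fun i j => j.elim (d i) (A i)) c
        ⟨fun j => j.elim b x, fun i => by simpa [Fintype.sum_option, add_comm] using hx i⟩
      exact ⟨y none, fun j => y (some j), fun i => by
        simpa [Fintype.sum_option, add_comm] using hy i⟩
    · rintro _ ⟨ι₁, κ₁, _, _, A₁, d₁, c₁, ⟨x₁, hx₁⟩, rfl⟩ _ ⟨ι₂, κ₂, _, _, A₂, d₂, c₂, ⟨x₂, hx₂⟩, rfl⟩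
      refine ⟨ι₁ ⊕ ι₂, κ₁ ⊕ κ₂, inferInstance, inferInstance,
        Sum.elim (fun i => Sum.elim (A₁ i) 0) (fun i => Sum.elim 0 (A₂ i)),
        Sum.elim d₁ d₂, Sum.elim c₁ c₂, ⟨Sum.elim x₁ x₂, ?_⟩, ?_⟩
      · rintro (i | i)
        · simpa using hx₁ i
        · simpa using hx₂ i
      · ext s
        rw [AffineSubspace.mem_inf_iff]
        simp only [mem_solutionCoset]
        constructor
        · rintro ⟨⟨y₁, h₁⟩, y₂, h₂⟩
          refine ⟨Sum.elim y₁ y₂, ?_⟩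
          rintro (i | i)
          · simpa using h₁ i
          · simpa using h₂ i
        · rintro ⟨y, hy⟩
          exact ⟨⟨fun j => y (.inl j), fun i => by simpa using hy (.inl i)⟩,
            ⟨fun j => y (.inr j), fun i => by simpa using hy (.inr i)⟩⟩
  exact ⟨s, fun ι κ _ _ A d c h => hs _ ⟨ι, κ, inferInstance, inferInstance, A, d, c, h, rfl⟩⟩

theorem PreservesSolvability.exists_extension [IsArtinian R S] {f : B →ₗ.[R] S}
    (hf : PreservesSolvability f) (b : B) :
    ∃ g : B →ₗ.[R] S, f ≤ g ∧ PreservesSolvability g ∧ b ∈ g.domain := by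
  obtain ⟨s, hs⟩ := hf.exists_image b
  have key (r : R) (x : f.domain) (h : r • b = (x : B)) : r • s = f x := by
    obtain ⟨_, hy⟩ := hs Unit Empty (fun _ => Empty.elim) (fun _ => r) (fun _ => x)
      ⟨Empty.elim, fun _ => by simpa using h⟩
    simpa using hy ()
  let e := LinearPMap.mkSpanSingleton' (σ := RingHom.id R) b s
    fun r h => by simpa using key r 0 (by simpa using h)
  have he (r : R) (h) : e ⟨r • b, h⟩ = r • s := LinearPMap.mkSpanSingleton'_apply _ _ _ r h
  have hcompat : ∀ (x : f.domain) (y : e.domain), (x : B) = y → f x = e y := by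
    rintro x ⟨y, hy⟩ hxy
    obtain ⟨r, rfl⟩ := Submodule.mem_span_singleton.1 hy
    rw [he]
    exact (key r x hxy.symm).symm
  refine ⟨f.sup e hcompat, f.left_le_sup e hcompat, ?_,
    (f.right_le_sup e hcompat).1 (Submodule.mem_span_singleton_self b)⟩
  intro ι κ _ _ A c ⟨x, hx⟩
  have hdec (i : ι) : ∃ (n : f.domain) (r : R), (n : B) + r • b = c i := by
    obtain ⟨n, hn, z, hz, h⟩ := Submodule.mem_sup.1 (c i).2
    obtain ⟨r, rfl⟩ := Submodule.mem_span_singleton.1 hz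
    exact ⟨⟨n, hn⟩, r, h⟩
  choose n r hnr using hdec
  obtain ⟨y, hy⟩ := hs ι κ A (fun i => -r i) n ⟨x, fun i => by rw [hx, ← hnr]; simp⟩
  refine ⟨y, fun i => ?_⟩
  have hr : r i • b ∈ e.domain := Submodule.mem_span_singleton.2 ⟨r i, rfl⟩
  rw [LinearPMap.sup_apply hcompat (n i) ⟨r i • b, hr⟩ (c i) (hnr i), he, ← hy i]
  simp

theorem PreservesSolvability.sSup {C : Set (B →ₗ.[R] S)} (hC : DirectedOn (· ≤ ·) C)
    (hne : C.Nonempty) (h : ∀ f ∈ C, PreservesSolvability f) :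
    PreservesSolvability (LinearPMap.sSup C hC) := by
  intro ι κ _ _ A c hx
  have hmem (i : ι) := (LinearPMap.mem_domain_sSup_iff hne hC).1 (c i).2
  choose g hg hcg using hmem
  -- A finite system involves finitely many members of `C` only.
  obtain ⟨f, hf⟩ : ∃ f : C, ∀ i, g i ≤ f := by
    have : Nonempty C := hne.to_subtype
    obtain ⟨f, hf⟩ := (directedOn_iff_directed.1 hC).finite_le fun i => ⟨g i, hg i⟩
    exact ⟨f, hf⟩
  have hcf (i : ι) : (c i : B) ∈ f.1.domain := (hf i).1 (hcg i)
  obtain ⟨y, hy⟩ := h f f.2 ι κ A (fun i => ⟨c i, hcf i⟩) hx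
  exact ⟨y, fun i => (hy i).trans (LinearPMap.sSup_apply hC f.2 ⟨c i, hcf i⟩).symm⟩

/-- A homomorphism defined on a pure submodule preserves solvability. -/
theorem IsPure.preservesSolvability {N : Submodule R B} (hN : IsPure N) (f : N →ₗ[R] S) :
    PreservesSolvability (⟨N, f⟩ : B →ₗ.[R] S) := by
  rintro ι κ _ _ A c ⟨x, hx⟩
  let e := Fintype.equivFin ι
  let u := Fintype.equivFin κ
  obtain ⟨y, hy⟩ := hN _ _ (fun i j => A (e.symm i) (u.symm j)) (fun i => c (e.symm i))
    ⟨fun j => x (u.symm j), fun i => by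
      rw [← hx]; exact Equiv.sum_comp u.symm fun j => A (e.symm i) j • x j⟩
  refine ⟨fun j => f (y (u j)), fun i => ?_⟩
  have h := hy (e i)
  rw [Equiv.symm_apply_apply] at h
  rw [← Equiv.sum_comp u.symm]
  change _ = f (c i)
  rw [← h, map_sum]
  simp

/-- Extend a homomorphism one element at a time, keeping solvability preserved, and use Zorn's
lemma. -/
theorem isPureInjective_of_isArtinian (S : Type*) [AddCommGroup S] [Module R S]
    [IsArtinian R S] : IsPureInjective.{w} R S := by
  intro B _ _ N hN f
  obtain ⟨m, hfm, hm⟩ := zorn_le_nonempty₀ {g : B →ₗ.[R] S | PreservesSolvability g}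
    (fun C hC hchain y hy =>
      ⟨LinearPMap.sSup C hchain.directedOn, PreservesSolvability.sSup _ ⟨y, hy⟩ hC,
        fun z hz => LinearPMap.le_sSup _ hz⟩) ⟨N, f⟩ (hN.preservesSolvability f)
  have htop (b : B) : b ∈ m.domain := by
    obtain ⟨g, hmg, hg, hb⟩ := hm.prop.exists_extension b
    exact (hm.le_of_ge hg hmg).1 hb
  refine ⟨m.toFun ∘ₗ LinearMap.id.codRestrict m.domain htop, fun x => ?_⟩
  exact (hfm.2 (x := x) (y := ⟨x, htop x⟩) rfl).symm

end PureInjective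

/-! ### Multiplication modules over local rings -/

/-- A module over a local ring all of whose submodules are of the form `I M` is cyclic: a vector
outside `𝔪 M` generates `M`, and if `𝔪 M = M` then `R x = 𝔪 x` for each `x`, so that `M = 0` by
Nakayama's lemma. -/
theorem exists_span_singleton_eq_top_of_isLocalRing {R M : Type*} [CommRing R] [IsLocalRing R]
    [AddCommGroup M] [Module R M]
    (h : ∀ N : Submodule R M, ∃ I : Ideal R, N = I • (⊤ : Submodule R M)) :
    ∃ m : M, Submodule.span R {m} = ⊤ := by
  by_cases hM : IsLocalRing.maximalIdeal R • (⊤ : Submodule R M) = ⊤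
  · refine ⟨0, ?_⟩
    rw [eq_top_iff]
    intro x _
    obtain ⟨I, hI⟩ := h (Submodule.span R {x})
    have hx : Submodule.span R {x} = ⊥ := by
      refine Submodule.eq_bot_of_le_smul_of_le_jacobson_bot (IsLocalRing.maximalIdeal R) _
        (Submodule.fg_span_singleton x) ?_ (IsLocalRing.maximalIdeal_le_jacobson _)
      conv_lhs => rw [hI, ← hM]
      rw [hI, ← Submodule.mul_smul, ← Submodule.mul_smul, mul_comm]
    rw [Submodule.span_singleton_eq_bot.1 hx]
    exact zero_mem _
  · obtain ⟨m, hm⟩ : ∃ m, m ∉ IsLocalRing.maximalIdeal R • (⊤ : Submodule R M) := by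
      by_contra! hall
      exact hM (eq_top_iff.2 fun x _ => hall x)
    obtain ⟨I, hI⟩ := h (Submodule.span R {m})
    refine ⟨m, ?_⟩
    by_cases hItop : I = ⊤
    · rw [hI, hItop, Submodule.top_smul]
    · refine absurd ?_ hm
      have hmem : m ∈ I • (⊤ : Submodule R M) := hI ▸ Submodule.mem_span_singleton_self m
      exact Submodule.smul_mono_left (IsLocalRing.le_maximalIdeal hItop) hmem

/-! ### The pullback ring and separated modules -/

section Pullback

variable {R₁ R₂ k : Type*} [CommRing R₁] [CommRing R₂] [Field k] (v₁ : R₁ →+* k) (v₂ : R₂ →+* k)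

/-- The projection of the pullback ring to `R₁`. -/
abbrev pullbackFst : pullbackRing v₁ v₂ →+* R₁ :=
  (RingHom.fst R₁ R₂).comp (pullbackRing v₁ v₂).subtype

/-- The projection of the pullback ring to `R₂`. -/
abbrev pullbackSnd : pullbackRing v₁ v₂ →+* R₂ :=
  (RingHom.snd R₁ R₂).comp (pullbackRing v₁ v₂).subtype

/-- The ideal `ker v₁ ⊕ 0` of the pullback ring, that is, the kernel of the second projection. -/
abbrev leftIdeal : Ideal (pullbackRing v₁ v₂) := RingHom.ker (pullbackSnd v₁ v₂)

/-- The ideal `0 ⊕ ker v₂` of the pullback ring, that is, the kernel of the first projection. -/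
abbrev rightIdeal : Ideal (pullbackRing v₁ v₂) := RingHom.ker (pullbackFst v₁ v₂)

variable {v₁ v₂}

theorem pullbackFst_surjective (hv₂ : Function.Surjective v₂) :
    Function.Surjective (pullbackFst v₁ v₂) := fun r =>
  let ⟨s, hs⟩ := hv₂ (v₁ r)
  ⟨⟨(r, s), hs.symm⟩, rfl⟩

theorem pullbackSnd_surjective (hv₁ : Function.Surjective v₁) :
    Function.Surjective (pullbackSnd v₁ v₂) := fun s =>
  let ⟨r, hr⟩ := hv₁ (v₂ s)
  ⟨⟨(r, s), hr⟩, rfl⟩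

/-- Given a surjective ring homomorphism `π : R → A`, the module `S / (ker π) S` is an
`A`-module. -/
noncomputable abbrev quotientKerSMulModule {R A : Type*} [CommRing R] [CommRing A] (π : R →+* A)
    (hπ : Function.Surjective π) (S : Type*) [AddCommGroup S] [Module R S] :
    Module A (S ⧸ (RingHom.ker π • (⊤ : Submodule R S))) :=
  Module.compHom _ (RingHom.quotientKerEquivOfSurjective hπ).symm.toRingHom

theorem quotientKerSMulModule_smul {R A : Type*} [CommRing R] [CommRing A] (π : R →+* A)
    (hπ : Function.Surjective π) (S : Type*) [AddCommGroup S] [Module R S] (r : R)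
    (x : S ⧸ (RingHom.ker π • (⊤ : Submodule R S))) :
    letI := quotientKerSMulModule π hπ S
    π r • x = r • x := by
  have h : (RingHom.quotientKerEquivOfSurjective hπ).symm (π r) =
      Ideal.Quotient.mk (RingHom.ker π) r := by
    rw [RingEquiv.symm_apply_eq]
    rfl
  change (RingHom.quotientKerEquivOfSurjective hπ).symm (π r) • x = _
  rw [h]
  obtain ⟨y, rfl⟩ := Submodule.Quotient.mk_surjective _ x
  rfl

/-- If `P₁ S ∩ P₂ S = 0`, then `S` embeds in `S / P₂ S ⊕ S / P₁ S`. -/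
theorem isSeparated_of_disjoint (hv₁ : Function.Surjective v₁) (hv₂ : Function.Surjective v₂)
    {S : Type w} [AddCommGroup S] [Module (pullbackRing v₁ v₂) S]
    (h : Disjoint (leftIdeal v₁ v₂ • (⊤ : Submodule (pullbackRing v₁ v₂) S))
      (rightIdeal v₁ v₂ • ⊤)) :
    IsSeparated v₁ v₂ S := by
  refine ⟨S ⧸ (rightIdeal v₁ v₂ • (⊤ : Submodule (pullbackRing v₁ v₂) S)),
    S ⧸ (leftIdeal v₁ v₂ • (⊤ : Submodule (pullbackRing v₁ v₂) S)), inferInstance, inferInstance,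
    quotientKerSMulModule (pullbackFst v₁ v₂) (pullbackFst_surjective hv₂) S,
    quotientKerSMulModule (pullbackSnd v₁ v₂) (pullbackSnd_surjective hv₁) S,
    ((Submodule.mkQ _).prod (Submodule.mkQ _)).toAddMonoidHom, ?_, ?_⟩
  · rw [injective_iff_map_eq_zero]
    intro x hx
    have h₁ := (Submodule.Quotient.mk_eq_zero _).1 (congrArg Prod.fst hx)
    have h₂ := (Submodule.Quotient.mk_eq_zero _).1 (congrArg Prod.snd hx)
    exact Submodule.disjoint_def.1 h x h₂ h₁
  · intro r x
    refine Prod.ext ?_ ?_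
    · exact (quotientKerSMulModule_smul (pullbackFst v₁ v₂) (pullbackFst_surjective hv₂) S r (Submodule.Quotient.mk x)).symm
    · exact (quotientKerSMulModule_smul (pullbackSnd v₁ v₂) (pullbackSnd_surjective hv₁) S r (Submodule.Quotient.mk x)).symm

theorem IsSeparated.disjoint {S : Type w} [AddCommGroup S] [Module (pullbackRing v₁ v₂) S]
    (h : IsSeparated v₁ v₂ S) :
    Disjoint (leftIdeal v₁ v₂ • (⊤ : Submodule (pullbackRing v₁ v₂) S))
      (rightIdeal v₁ v₂ • ⊤) := by
  obtain ⟨S₁, S₂, _, _, _, _, f, hinj, hf⟩ := h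
  rw [Submodule.disjoint_def]
  intro x h₁ h₂
  have hsnd : (f x).2 = 0 := by
    refine Submodule.smul_induction_on h₁ (fun r hr y _ => ?_) (fun y z hy hz => ?_)
    · have hr0 : r.1.2 = 0 := hr
      rw [hf, hr0, zero_smul]
    · rw [map_add, Prod.snd_add, hy, hz, add_zero]
  have hfst : (f x).1 = 0 := by
    refine Submodule.smul_induction_on h₂ (fun r hr y _ => ?_) (fun y z hy hz => ?_)
    · have hr0 : r.1.1 = 0 := hr
      rw [hf, hr0, zero_smul]
    · rw [map_add, Prod.fst_add, hy, hz, add_zero]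
  exact hinj (by rw [map_zero]; exact Prod.ext hfst hsnd)

theorem isSeparated_quotient (hv₁ : Function.Surjective v₁) (hv₂ : Function.Surjective v₂)
    {S : Type w} [AddCommGroup S] [Module (pullbackRing v₁ v₂) S]
    (L : Submodule (pullbackRing v₁ v₂) S)
    (h : ∀ a ∈ leftIdeal v₁ v₂ • (⊤ : Submodule (pullbackRing v₁ v₂) S),
      ∀ b ∈ rightIdeal v₁ v₂ • (⊤ : Submodule (pullbackRing v₁ v₂) S), a - b ∈ L → a ∈ L) :
    IsSeparated v₁ v₂ (S ⧸ L) := by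
  apply isSeparated_of_disjoint hv₁ hv₂
  have hmap (I : Ideal (pullbackRing v₁ v₂)) :
      I • (⊤ : Submodule (pullbackRing v₁ v₂) (S ⧸ L)) = (I • ⊤ : Submodule _ S).map L.mkQ := by
    rw [Submodule.map_smul'', Submodule.map_top, Submodule.range_mkQ]
  rw [hmap, hmap, Submodule.disjoint_def]
  rintro _ ⟨a, ha, rfl⟩ ⟨b, hb, hab⟩
  rw [Submodule.mkQ_apply, Submodule.Quotient.mk_eq_zero]
  exact h a ha b hb ((Submodule.Quotient.eq L).1 hab.symm)

/-! ### The kernel of a separated representation -/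

namespace IsSeparatedRepresentation

variable {S : Type w} [AddCommGroup S] [Module (pullbackRing v₁ v₂) S]
  {M : Type*} [AddCommGroup M] [Module (pullbackRing v₁ v₂) M]
  {φ : S →ₗ[pullbackRing v₁ v₂] M}

/-- Minimality of the representation, stated in terms of submodules of its kernel. -/
theorem eq_bot_of_le_ker (hφ : IsSeparatedRepresentation φ) (hv₁ : Function.Surjective v₁)
    (hv₂ : Function.Surjective v₂) (L : Submodule (pullbackRing v₁ v₂) S)
    (hL : L ≤ LinearMap.ker φ)
    (h : ∀ a ∈ leftIdeal v₁ v₂ • (⊤ : Submodule (pullbackRing v₁ v₂) S),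
      ∀ b ∈ rightIdeal v₁ v₂ • (⊤ : Submodule (pullbackRing v₁ v₂) S), a - b ∈ L → a ∈ L) :
    L = ⊥ := by
  have hinj := hφ.injective_of_factorization (S ⧸ L) L.mkQ (L.liftQ φ hL)
    (isSeparated_quotient hv₁ hv₂ L h) (L.liftQ_mkQ φ hL).symm
  rw [← L.ker_mkQ, LinearMap.ker_eq_bot.2 hinj]

theorem disjoint_ker_leftIdeal_smul (hφ : IsSeparatedRepresentation φ)
    (hv₁ : Function.Surjective v₁) (hv₂ : Function.Surjective v₂) :
    Disjoint (LinearMap.ker φ) (leftIdeal v₁ v₂ • ⊤) := by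
  rw [disjoint_iff]
  refine hφ.eq_bot_of_le_ker hv₁ hv₂ _ inf_le_left fun a ha b hb hab => ?_
  have hb' : b ∈ leftIdeal v₁ v₂ • (⊤ : Submodule (pullbackRing v₁ v₂) S) := by
    simpa using sub_mem ha hab.2
  have hb0 : b = 0 := Submodule.disjoint_def.1 hφ.separated.disjoint b hb' hb
  simpa [hb0] using hab

theorem disjoint_ker_rightIdeal_smul (hφ : IsSeparatedRepresentation φ)
    (hv₁ : Function.Surjective v₁) (hv₂ : Function.Surjective v₂) :
    Disjoint (LinearMap.ker φ) (rightIdeal v₁ v₂ • ⊤) := by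
  rw [disjoint_iff]
  refine hφ.eq_bot_of_le_ker hv₁ hv₂ _ inf_le_left fun a ha b hb hab => ?_
  have ha' : a ∈ rightIdeal v₁ v₂ • (⊤ : Submodule (pullbackRing v₁ v₂) S) := by
    simpa using add_mem hab.2 hb
  have ha0 : a = 0 := Submodule.disjoint_def.1 hφ.separated.disjoint a ha ha'
  rw [ha0]
  exact zero_mem _

theorem smul_eq_zero_of_mem_sup (hφ : IsSeparatedRepresentation φ)
    (hv₁ : Function.Surjective v₁) (hv₂ : Function.Surjective v₂)
    {p : pullbackRing v₁ v₂} (hp : p ∈ leftIdeal v₁ v₂ ⊔ rightIdeal v₁ v₂) {x : S}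
    (hx : φ x = 0) : p • x = 0 := by
  obtain ⟨p₁, h₁, p₂, h₂, rfl⟩ := Submodule.mem_sup.1 hp
  have hx' : x ∈ LinearMap.ker φ := hx
  have e₁ : p₁ • x = 0 := Submodule.disjoint_def.1 (hφ.disjoint_ker_leftIdeal_smul hv₁ hv₂) _
    (Submodule.smul_mem _ _ hx') (Submodule.smul_mem_smul h₁ Submodule.mem_top)
  have e₂ : p₂ • x = 0 := Submodule.disjoint_def.1 (hφ.disjoint_ker_rightIdeal_smul hv₁ hv₂) _
    (Submodule.smul_mem _ _ hx') (Submodule.smul_mem_smul h₂ Submodule.mem_top)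
  rw [add_smul, e₁, e₂, add_zero]

end IsSeparatedRepresentation

end Pullback

/-! ### Pullbacks of local rings -/

section LocalPullback

variable {R₁ R₂ k : Type*} [CommRing R₁] [IsLocalRing R₁] [CommRing R₂] [IsLocalRing R₂] [Field k]
  {v₁ : R₁ →+* k} {v₂ : R₂ →+* k}

theorem mem_maximalIdeal_iff_of_surjective {A : Type*} [CommRing A] [IsLocalRing A] {v : A →+* k}
    (hv : Function.Surjective v) {a : A} : a ∈ IsLocalRing.maximalIdeal A ↔ v a = 0 := by
  rw [← IsLocalRing.eq_maximalIdeal (RingHom.ker_isMaximal_of_surjective v hv), RingHom.mem_ker]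

theorem mem_idealP_iff (hv₁ : Function.Surjective v₁) (hv₂ : Function.Surjective v₂)
    {r : pullbackRing v₁ v₂} : r ∈ idealP v₁ v₂ ↔ v₁ r.1.1 = 0 := by
  change r.1.1 ∈ IsLocalRing.maximalIdeal R₁ ∧ r.1.2 ∈ IsLocalRing.maximalIdeal R₂ ↔ _
  rw [mem_maximalIdeal_iff_of_surjective hv₁, mem_maximalIdeal_iff_of_surjective hv₂]
  have hr : v₁ r.1.1 = v₂ r.1.2 := r.2
  rw [← hr, and_self]

theorem idealP_eq_sup (hv₁ : Function.Surjective v₁) (hv₂ : Function.Surjective v₂) :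
    idealP v₁ v₂ = leftIdeal v₁ v₂ ⊔ rightIdeal v₁ v₂ := by
  ext r
  have hr : v₁ r.1.1 = v₂ r.1.2 := r.2
  rw [mem_idealP_iff hv₁ hv₂, Submodule.mem_sup]
  constructor
  · intro h
    refine ⟨⟨(r.1.1, 0), ?_⟩, rfl, ⟨(0, r.1.2), ?_⟩, rfl, ?_⟩
    · change v₁ r.1.1 = v₂ 0
      rw [h, map_zero]
    · change v₁ 0 = v₂ r.1.2
      rw [← hr, h, map_zero]
    · ext <;> simp
  · rintro ⟨p, hp, q, hq, rfl⟩
    have hp' : p.1.2 = 0 := hp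
    have hq' : q.1.1 = 0 := hq
    have hpv : v₁ p.1.1 = v₂ p.1.2 := p.2
    simp [hq', hpv, hp']

theorem isUnit_of_notMem_idealP (hv₁ : Function.Surjective v₁) (hv₂ : Function.Surjective v₂)
    {r : pullbackRing v₁ v₂} (hr : r ∉ idealP v₁ v₂) : IsUnit r := by
  have hr₁ : v₁ r.1.1 ≠ 0 := fun h => hr ((mem_idealP_iff hv₁ hv₂).2 h)
  have hrv : v₁ r.1.1 = v₂ r.1.2 := r.2
  have u₁ : IsUnit r.1.1 := by
    by_contra h
    exact hr₁ ((mem_maximalIdeal_iff_of_surjective hv₁).1 h)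
  have u₂ : IsUnit r.1.2 := by
    by_contra h
    exact hr₁ (hrv.trans ((mem_maximalIdeal_iff_of_surjective hv₂).1 h))
  obtain ⟨s₁, hs₁⟩ := u₁.exists_right_inv
  obtain ⟨s₂, hs₂⟩ := u₂.exists_right_inv
  have hs : v₁ s₁ = v₂ s₂ := by
    apply mul_left_cancel₀ hr₁
    rw [← map_mul, hs₁, hrv, ← map_mul, hs₂, map_one, map_one]
  exact IsUnit.of_mul_eq_one ⟨(s₁, s₂), hs⟩ (Subtype.ext (Prod.ext hs₁ hs₂))

theorem isLocalRing_pullbackRing (hv₁ : Function.Surjective v₁) (hv₂ : Function.Surjective v₂) :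
    IsLocalRing (pullbackRing v₁ v₂) := by
  have : IsLocalHom (v₁.comp (pullbackFst v₁ v₂)) := ⟨fun r hr =>
    isUnit_of_notMem_idealP hv₁ hv₂ fun h => hr.ne_zero ((mem_idealP_iff hv₁ hv₂).1 h)⟩
  exact RingHom.domain_isLocalRing (v₁.comp (pullbackFst v₁ v₂))

section

variable {S : Type w} [AddCommGroup S] [Module (pullbackRing v₁ v₂) S]
  {M : Type*} [AddCommGroup M] [Module (pullbackRing v₁ v₂) M]
  {φ : S →ₗ[pullbackRing v₁ v₂] M}

theorem IsSeparatedRepresentation.smul_eq_zero (hφ : IsSeparatedRepresentation φ)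
    (hv₁ : Function.Surjective v₁) (hv₂ : Function.Surjective v₂)
    {p : pullbackRing v₁ v₂} (hp : p ∈ idealP v₁ v₂) {x : S} (hx : φ x = 0) : p • x = 0 :=
  hφ.smul_eq_zero_of_mem_sup hv₁ hv₂ (idealP_eq_sup hv₁ hv₂ ▸ hp) hx

/-- If a kernel element `x` were not in `P S`, then `R x` would be a nonzero submodule of the
kernel meeting `P S` trivially, and `S / R x` would still be separated. -/
theorem IsSeparatedRepresentation.ker_le_idealP_smul (hφ : IsSeparatedRepresentation φ)
    (hv₁ : Function.Surjective v₁) (hv₂ : Function.Surjective v₂) :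
    LinearMap.ker φ ≤ idealP v₁ v₂ • ⊤ := by
  intro x hx
  by_contra hxP
  have hdisj : ∀ y ∈ Submodule.span (pullbackRing v₁ v₂) {x},
      y ∈ idealP v₁ v₂ • (⊤ : Submodule (pullbackRing v₁ v₂) S) → y = 0 := by
    intro y hy hyP
    obtain ⟨r, rfl⟩ := Submodule.mem_span_singleton.1 hy
    by_cases hr : r ∈ idealP v₁ v₂
    · exact hφ.smul_eq_zero hv₁ hv₂ hr hx
    · exact absurd ((Submodule.smul_mem_iff_of_isUnit _
        (isUnit_of_notMem_idealP hv₁ hv₂ hr)).1 hyP) hxP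
  have hbot := hφ.eq_bot_of_le_ker hv₁ hv₂ (Submodule.span _ {x})
    ((Submodule.span_singleton_le_iff_mem _ _).2 hx) ?_
  · rw [Submodule.span_singleton_eq_bot.1 hbot] at hxP
    exact hxP (zero_mem _)
  · intro a ha b hb hab
    have hsup := idealP_eq_sup hv₁ hv₂
    have ha' := Submodule.smul_mono_left (N := ⊤) (hsup ▸ le_sup_left) ha
    have hb' := Submodule.smul_mono_left (N := ⊤) (hsup ▸ le_sup_right) hb
    have hab0 := hdisj _ hab (sub_mem ha' hb')
    rw [sub_eq_zero.1 hab0] at ha ⊢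
    have hb0 : b = 0 := Submodule.disjoint_def.1 hφ.separated.disjoint b ha hb
    rw [hb0]
    exact zero_mem _

/-- A separated representation induces an isomorphism on tops, since its kernel lies in `P S`. -/
noncomputable def IsSeparatedRepresentation.topEquiv (hφ : IsSeparatedRepresentation φ)
    (hv₁ : Function.Surjective v₁) (hv₂ : Function.Surjective v₂) :
    ModuleTop v₁ v₂ S ≃ₗ[pullbackRing v₁ v₂ ⧸ idealP v₁ v₂] ModuleTop v₁ v₂ M :=
  have hmap : (idealP v₁ v₂ • (⊤ : Submodule (pullbackRing v₁ v₂) S)).map φ =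
      idealP v₁ v₂ • ⊤ := by
    rw [Submodule.map_smul'', Submodule.map_top, LinearMap.range_eq_top.2 hφ.surjective]
  LinearEquiv.extendScalarsOfSurjective (R := pullbackRing v₁ v₂) Ideal.Quotient.mk_surjective <|
    LinearEquiv.ofBijective (Submodule.mapQ _ _ φ (Submodule.map_le_iff_le_comap.1 hmap.le)) <| by
      constructor
      · rw [← LinearMap.ker_eq_bot, Submodule.ker_mapQ, ← hmap, Submodule.comap_map_eq,
          sup_eq_left.2 (hφ.ker_le_idealP_smul hv₁ hv₂), Submodule.mkQ_map_self]
      · intro y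
        obtain ⟨z, rfl⟩ := Submodule.Quotient.mk_surjective _ y
        obtain ⟨x, rfl⟩ := hφ.surjective z
        exact ⟨Submodule.Quotient.mk x, rfl⟩

/-- A lift of a generator generates: `S = R s + K` with `K ⊆ P S` and `P K = 0`, whence
`P S = P s`. -/
theorem IsSeparatedRepresentation.span_singleton_eq_top (hφ : IsSeparatedRepresentation φ)
    (hv₁ : Function.Surjective v₁) (hv₂ : Function.Surjective v₂) {s : S}
    (hs : Submodule.span (pullbackRing v₁ v₂) {φ s} = ⊤) :
    Submodule.span (pullbackRing v₁ v₂) {s} = ⊤ := by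
  have hdec (x : S) : ∃ r : pullbackRing v₁ v₂, φ (x - r • s) = 0 := by
    obtain ⟨r, hr⟩ := Submodule.mem_span_singleton.1 (hs ▸ Submodule.mem_top : φ x ∈ _)
    exact ⟨r, by rw [map_sub, map_smul, hr, sub_self]⟩
  have hP : idealP v₁ v₂ • (⊤ : Submodule (pullbackRing v₁ v₂) S) ≤ Submodule.span _ {s} := by
    rw [Submodule.smul_le]
    intro p hp x _
    obtain ⟨r, hr⟩ := hdec x
    have h0 := hφ.smul_eq_zero hv₁ hv₂ hp hr
    rw [smul_sub, sub_eq_zero] at h0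
    rw [h0]
    exact Submodule.smul_mem _ _ (Submodule.smul_mem _ _ (Submodule.mem_span_singleton_self s))
  rw [eq_top_iff]
  intro x _
  obtain ⟨r, hr⟩ := hdec x
  have hx : x - r • s ∈ Submodule.span _ {s} := hP (hφ.ker_le_idealP_smul hv₁ hv₂ hr)
  simpa using add_mem hx (Submodule.smul_mem _ r (Submodule.mem_span_singleton_self s))

/-- As `M = R m` is not separated, some nonzero `p₁ m = p₂ m` lies in `P₁ M ∩ P₂ M`. Then
`d = p₁ - p₂` has nonzero components and `d s` is in the kernel of `φ`, which is killed by `P`. -/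
theorem IsSeparatedRepresentation.exists_smul_eq_zero (hφ : IsSeparatedRepresentation φ)
    (hv₁ : Function.Surjective v₁) (hv₂ : Function.Surjective v₂) {s : S}
    (hs : Submodule.span (pullbackRing v₁ v₂) {φ s} = ⊤) (hM : ¬ IsSeparated v₁ v₂ M) :
    ∃ d ∈ idealP v₁ v₂, d.1.1 ≠ 0 ∧ d.1.2 ≠ 0 ∧ ∀ p ∈ idealP v₁ v₂, (p * d) • s = 0 := by
  have hinf := mt disjoint_iff.2 (mt (isSeparated_of_disjoint hv₁ hv₂) hM)
  obtain ⟨x, ⟨hx₁, hx₂⟩, hx0⟩ := Submodule.exists_mem_ne_zero_of_ne_bot hinf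
  rw [SetLike.mem_coe, ← hs, Submodule.mem_smul_span_singleton] at hx₁ hx₂
  obtain ⟨p₁, h₁, e₁⟩ := hx₁
  obtain ⟨p₂, h₂, e₂⟩ := hx₂
  have h₁' : p₁.1.2 = 0 := h₁
  have h₂' : p₂.1.1 = 0 := h₂
  refine ⟨p₁ - p₂, ?_, ?_, ?_, fun p hp => ?_⟩
  · rw [idealP_eq_sup hv₁ hv₂]
    exact sub_mem (Submodule.mem_sup_left h₁) (Submodule.mem_sup_right h₂)
  · intro h
    have : p₁ = 0 := Subtype.ext (Prod.ext (by simpa [h₂'] using h) h₁')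
    exact hx0 (by rw [← e₁, this, zero_smul])
  · intro h
    have : p₂ = 0 := Subtype.ext (Prod.ext h₂' (by simpa [h₁'] using h))
    exact hx0 (by rw [← e₂, this, zero_smul])
  · rw [mul_smul]
    exact hφ.smul_eq_zero hv₁ hv₂ hp (by rw [map_smul, sub_smul, e₁, e₂, sub_self])

end

end LocalPullback

/-! ### Pullbacks of discrete valuation rings -/

theorem exists_dvd_pow_of_mem_maximalIdeal {A : Type*} [CommRing A] [IsDomain A]
    [IsDiscreteValuationRing A] {a b : A} (ha : a ≠ 0) (hb : b ∈ IsLocalRing.maximalIdeal A) :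
    ∃ n : ℕ, a ∣ b ^ n := by
  obtain ⟨ϖ, hϖ⟩ := IsDiscreteValuationRing.exists_irreducible A
  obtain ⟨n, u, rfl⟩ := IsDiscreteValuationRing.eq_unit_mul_pow_irreducible ha hϖ
  refine ⟨n, (Units.mul_left_dvd).2 (pow_dvd_pow_of_dvd ?_ n)⟩
  rwa [hϖ.maximalIdeal_eq, Ideal.mem_span_singleton] at hb

/-- If the kernels of surjections of `R` onto `A₁` and `A₂` meet in an ideal that kills a generator
of `S`, then `S` is a quotient of a submodule of `A₁ ⊕ A₂`. -/
theorem isArtinian_of_ker_inf_ker_smul_eq_zero {R A₁ A₂ : Type*} [CommRing R] [CommRing A₁]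
    [CommRing A₂] [IsArtinianRing A₁] [IsArtinianRing A₂] {f₁ : R →+* A₁} {f₂ : R →+* A₂}
    (hf₁ : Function.Surjective f₁) (hf₂ : Function.Surjective f₂)
    {S : Type*} [AddCommGroup S] [Module R S] {s : S} (hs : Submodule.span R {s} = ⊤)
    (h : ∀ r, f₁ r = 0 → f₂ r = 0 → r • s = 0) : IsArtinian R S := by
  let := f₁.toAlgebra
  let := f₂.toAlgebra
  have : IsArtinian R A₁ := isArtinian_of_surjective_algebraMap (R := A₁) hf₁
  have : IsArtinian R A₂ := isArtinian_of_surjective_algebraMap (R := A₂) hf₂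
  let ψ : R →ₗ[R] A₁ × A₂ := (Algebra.linearMap R A₁).prod (Algebra.linearMap R A₂)
  have : IsArtinian R (R ⧸ LinearMap.ker ψ) :=
    isArtinian_of_injective ((LinearMap.ker ψ).liftQ ψ le_rfl)
      (LinearMap.ker_eq_bot.1 (Submodule.ker_liftQ_eq_bot _ _ _ le_rfl))
  have hle : LinearMap.ker ψ ≤ LinearMap.ker (LinearMap.toSpanSingleton R S s) := fun r hr =>
    h r (congrArg Prod.fst hr) (congrArg Prod.snd hr)
  refine isArtinian_of_surjective _ ((LinearMap.ker ψ).liftQ _ hle) ?_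
  rw [← LinearMap.range_eq_top, Submodule.range_liftQ, LinearMap.range_toSpanSingleton, hs]

theorem isArtinianRing_quotient_span_singleton {A : Type*} [CommRing A] [IsDomain A]
    [IsDiscreteValuationRing A] {a : A} (ha : a ≠ 0) : IsArtinianRing (A ⧸ Ideal.span {a}) := by
  have := (isFiniteLength_iff_isNoetherian_isArtinian.1
    (isFiniteLength_quotient_span_singleton A (mem_nonZeroDivisors_of_ne_zero ha))).2
  exact isArtinian_of_tower A this

section DVRPullback

variable {R₁ R₂ k : Type*}
  [CommRing R₁] [IsDomain R₁] [IsDiscreteValuationRing R₁]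
  [CommRing R₂] [IsDomain R₂] [IsDiscreteValuationRing R₂] [Field k]
  {v₁ : R₁ →+* k} {v₂ : R₂ →+* k}

/-- A nonunit `y` is in the radical of `I` as soon as `I` has, for each nonzero component of `y`,
an element whose corresponding component is nonzero: then `(y₁ ^ n, 0)` and `(0, y₂ ^ n)` are in `I`
for large `n`. -/
theorem mem_radical_of_mem_idealP (hv₁ : Function.Surjective v₁) (hv₂ : Function.Surjective v₂)
    {I : Ideal (pullbackRing v₁ v₂)} {y : pullbackRing v₁ v₂} (hy : y ∈ idealP v₁ v₂)
    (h₁ : y.1.1 = 0 ∨ ∃ x ∈ I, x.1.1 ≠ 0) (h₂ : y.1.2 = 0 ∨ ∃ x ∈ I, x.1.2 ≠ 0) :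
    y ∈ I.radical := by
  have hy₁ : v₁ y.1.1 = 0 := (mem_idealP_iff hv₁ hv₂).1 hy
  have hy₂ : v₂ y.1.2 = 0 := (show v₁ y.1.1 = v₂ y.1.2 from y.2) ▸ hy₁
  obtain ⟨p, hpI, n, hp⟩ : ∃ p ∈ I, ∃ n, p.1 = (y.1.1 ^ (n + 1), 0) := by
    rcases h₁ with h | ⟨x, hx, hx0⟩
    · exact ⟨0, zero_mem _, 0, by ext <;> simp [h]⟩
    · obtain ⟨n, t, ht⟩ := exists_dvd_pow_of_mem_maximalIdeal hx0
        ((mem_maximalIdeal_iff_of_surjective hv₁).2 hy₁)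
      -- The factor `y₁` ensures that `(t y₁, 0)` is in the pullback ring.
      refine ⟨⟨(t * y.1.1, 0), by change v₁ _ = v₂ _; simp [hy₁]⟩ * x, I.mul_mem_left _ hx, n, ?_⟩
      ext
      · simp only [Subring.coe_mul, Prod.fst_mul, pow_succ, ht]
        ring
      · simp
  obtain ⟨q, hqI, m, hq⟩ : ∃ q ∈ I, ∃ n, q.1 = (0, y.1.2 ^ (n + 1)) := by
    rcases h₂ with h | ⟨x, hx, hx0⟩
    · exact ⟨0, zero_mem _, 0, by ext <;> simp [h]⟩
    · obtain ⟨n, t, ht⟩ := exists_dvd_pow_of_mem_maximalIdeal hx0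
        ((mem_maximalIdeal_iff_of_surjective hv₂).2 hy₂)
      refine ⟨⟨(0, t * y.1.2), by change v₁ _ = v₂ _; simp [hy₂]⟩ * x, I.mul_mem_left _ hx, n, ?_⟩
      ext
      · simp
      · simp only [Subring.coe_mul, Prod.snd_mul, pow_succ, ht]
        ring
  refine ⟨n + 1 + (m + 1), ?_⟩
  have : y ^ (n + 1 + (m + 1)) = y ^ (m + 1) * p + y ^ (n + 1) * q := by
    ext
    · simp [hp, hq, pow_add, mul_comm]
    · simp [hp, hq, pow_add]
  rw [this]
  exact add_mem (I.mul_mem_left _ hpI) (I.mul_mem_left _ hqI)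

/-- Every proper ideal is 2-absorbing primary. If `c` is a unit, then `a b ∈ I`; otherwise the
vanishing components of `a b c` decide which of the three alternatives holds. -/
theorem isTwoAbsorbingPrimary_of_ne_top (hv₁ : Function.Surjective v₁)
    (hv₂ : Function.Surjective v₂) {I : Ideal (pullbackRing v₁ v₂)} (hI : I ≠ ⊤) :
    IsTwoAbsorbingPrimary I := by
  refine ⟨hI, fun a b c habc => ?_⟩
  by_cases hc : c ∈ idealP v₁ v₂
  swap
  · exact Or.inl ((Ideal.mul_unit_mem_iff_mem I (isUnit_of_notMem_idealP hv₁ hv₂ hc)).1 habc)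
  have hac := mem_radical_of_mem_idealP hv₁ hv₂ (I := I) (Ideal.mul_mem_left _ a hc)
  have hbc := mem_radical_of_mem_idealP hv₁ hv₂ (I := I) (Ideal.mul_mem_left _ b hc)
  have key₁ : (∃ x ∈ I, x.1.1 ≠ 0) ∨ a.1.1 = 0 ∨ b.1.1 = 0 ∨ c.1.1 = 0 := by
    by_cases h : (a * b * c).1.1 = 0
    · right
      simpa [or_assoc] using h
    · exact Or.inl ⟨_, habc, h⟩
  have key₂ : (∃ x ∈ I, x.1.2 ≠ 0) ∨ a.1.2 = 0 ∨ b.1.2 = 0 ∨ c.1.2 = 0 := by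
    by_cases h : (a * b * c).1.2 = 0
    · right
      simpa [or_assoc] using h
    · exact Or.inl ⟨_, habc, h⟩
  have hab : (a * b).1.1 = 0 → (a * b).1.2 = 0 → a * b ∈ I := fun h₁ h₂ => by
    have : a * b = 0 := Subtype.ext (Prod.ext h₁ h₂)
    rw [this]
    exact zero_mem _
  simp only [Subring.coe_mul, Prod.fst_mul, Prod.snd_mul, mul_eq_zero] at hac hbc hab
  clear hc habc hI
  generalize (∃ x ∈ I, x.1.1 ≠ 0) = E₁ at *
  generalize (∃ x ∈ I, x.1.2 ≠ 0) = E₂ at *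
  grind only

/-- A pseudo-absorbing primary multiplication module is cyclic: the condition on
`(N :_R M)` holds for every proper submodule `N`. -/
theorem IsPseudoAbsorbingPrimaryMultiplication.exists_span_singleton_eq_top
    (hv₁ : Function.Surjective v₁) (hv₂ : Function.Surjective v₂)
    {M : Type*} [AddCommGroup M] [Module (pullbackRing v₁ v₂) M]
    (hM : IsPseudoAbsorbingPrimaryMultiplication (pullbackRing v₁ v₂) M) :
    ∃ m : M, Submodule.span (pullbackRing v₁ v₂) {m} = ⊤ := by
  have := isLocalRing_pullbackRing hv₁ hv₂
  refine exists_span_singleton_eq_top_of_isLocalRing fun N => ?_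
  by_cases hN : N = ⊤
  · exact ⟨⊤, by rw [hN, Submodule.top_smul]⟩
  · refine hM N ⟨hN, isTwoAbsorbingPrimary_of_ne_top hv₁ hv₂ fun h => hN ?_⟩
    rw [eq_top_iff]
    intro x _
    have h1 : (1 : pullbackRing v₁ v₂) ∈ N.colon Set.univ := h ▸ Submodule.mem_top
    simpa using Submodule.mem_colon.1 h1 x (Set.mem_univ x)

/-- A cyclic module killed by `P d`, for a nonunit `d` with nonzero components, is Artinian. -/
theorem isArtinian_of_idealP_mul_smul_eq_zero (hv₁ : Function.Surjective v₁)
    (hv₂ : Function.Surjective v₂) {S : Type*} [AddCommGroup S] [Module (pullbackRing v₁ v₂) S]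
    {s : S} (hs : Submodule.span (pullbackRing v₁ v₂) {s} = ⊤) {d : pullbackRing v₁ v₂}
    (hd : d ∈ idealP v₁ v₂) (hd₁ : d.1.1 ≠ 0) (hd₂ : d.1.2 ≠ 0)
    (h : ∀ p ∈ idealP v₁ v₂, (p * d) • s = 0) : IsArtinian (pullbackRing v₁ v₂) S := by
  have := isArtinianRing_quotient_span_singleton (pow_ne_zero 2 hd₁)
  have := isArtinianRing_quotient_span_singleton (pow_ne_zero 2 hd₂)
  refine isArtinian_of_ker_inf_ker_smul_eq_zero
    (f₁ := (Ideal.Quotient.mk (Ideal.span {d.1.1 ^ 2})).comp (pullbackFst v₁ v₂))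
    (f₂ := (Ideal.Quotient.mk (Ideal.span {d.1.2 ^ 2})).comp (pullbackSnd v₁ v₂))
    (Ideal.Quotient.mk_surjective.comp (pullbackFst_surjective hv₂))
    (Ideal.Quotient.mk_surjective.comp (pullbackSnd_surjective hv₁)) hs fun r h₁ h₂ => ?_
  obtain ⟨t, ht⟩ := Ideal.mem_span_singleton.1 (Ideal.Quotient.eq_zero_iff_mem.1 h₁)
  obtain ⟨u, hu⟩ := Ideal.mem_span_singleton.1 (Ideal.Quotient.eq_zero_iff_mem.1 h₂)
  have hd0 : v₁ d.1.1 = 0 := (mem_idealP_iff hv₁ hv₂).1 hd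
  have hd0' : v₂ d.1.2 = 0 := (show v₁ d.1.1 = v₂ d.1.2 from d.2) ▸ hd0
  -- Squaring the components of `d` makes `r` a multiple of `d` by an element of `P`.
  let p : pullbackRing v₁ v₂ :=
    ⟨(d.1.1 * t, d.1.2 * u), by change v₁ _ = v₂ _; simp [hd0, hd0']⟩
  have hr : r = p * d := by
    refine Subtype.ext (Prod.ext ?_ ?_)
    · exact ht.trans (by simp only [p, Subring.coe_mul, Prod.fst_mul]; ring)
    · exact hu.trans (by simp only [p, Subring.coe_mul, Prod.snd_mul]; ring)
  rw [hr]
  exact h p ((mem_idealP_iff hv₁ hv₂).2 (by simp [p, hd0]))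

end DVRPullback

end PullbackModules

theorem corollary4p3 {R₁ R₂ k : Type*}
    [CommRing R₁] [IsDomain R₁] [IsDiscreteValuationRing R₁]
    [CommRing R₂] [IsDomain R₂] [IsDiscreteValuationRing R₂] [Field k]
    (v₁ : R₁ →+* k) (v₂ : R₂ →+* k)
    (hv₁ : Function.Surjective v₁) (hv₂ : Function.Surjective v₂)
    {M : Type*} [AddCommGroup M] [Module (PullbackModules.pullbackRing v₁ v₂) M]
    {S : Type*} [AddCommGroup S] [Module (PullbackModules.pullbackRing v₁ v₂) S]
    (φ : S →ₗ[PullbackModules.pullbackRing v₁ v₂] M)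
    (hφ : PullbackModules.IsSeparatedRepresentation φ)
    (hind : PullbackModules.IsIndecomposable (PullbackModules.pullbackRing v₁ v₂) M)
    (hsep : ¬ PullbackModules.IsSeparated v₁ v₂ M)
    (hmul : PullbackModules.IsPseudoAbsorbingPrimaryMultiplication
      (PullbackModules.pullbackRing v₁ v₂) M)
    (htop : Module.Finite (PullbackModules.pullbackRing v₁ v₂ ⧸ PullbackModules.idealP v₁ v₂)
      (PullbackModules.ModuleTop v₁ v₂ M)) :
    PullbackModules.IsPureInjective.{w} (PullbackModules.pullbackRing v₁ v₂) S ∧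
    Module.Finite (PullbackModules.pullbackRing v₁ v₂ ⧸ PullbackModules.idealP v₁ v₂)
      (PullbackModules.ModuleTop v₁ v₂ S) ∧
    Nonempty (PullbackModules.ModuleTop v₁ v₂ S
      ≃ₗ[PullbackModules.pullbackRing v₁ v₂ ⧸ PullbackModules.idealP v₁ v₂]
        PullbackModules.ModuleTop v₁ v₂ M) := by 
  obtain ⟨m, hm⟩ := hmul.exists_span_singleton_eq_top hv₁ hv₂
  obtain ⟨s, rfl⟩ := hφ.surjective m
  obtain ⟨d, hd, hd₁, hd₂, hds⟩ := hφ.exists_smul_eq_zero hv₁ hv₂ hm hsep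
  have : IsArtinian (PullbackModules.pullbackRing v₁ v₂) S :=
    PullbackModules.isArtinian_of_idealP_mul_smul_eq_zero hv₁ hv₂
      (hφ.span_singleton_eq_top hv₁ hv₂ hm) hd hd₁ hd₂ hds
  let e := hφ.topEquiv hv₁ hv₂
  exact ⟨PullbackModules.isPureInjective_of_isArtinian S, Module.Finite.equiv e.symm, ⟨e⟩⟩
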